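/- Let $r > 0$ and let $\beta : [0, \pi) \to [-1, 1]$ be a measurable function with $\int_0^{\pi} \beta(u)\,(-\sin u, \cos u)\, du = (0,0)$. Extend $\beta$ to $[0, 2\pi)$ by $\beta(t+\pi) = -\beta(t)$ for $t \in [0,\pi)$, and then to a $2\pi$-periodic function on $\mathbb{R}$. Then the Fourier series of $\beta$ has nonzero coefficients only for $\sin(kt)$ and $\cos(kt)$ with $k$ odd and greater than $1$. Moreover, the curve $\mathbf{R}(t) = \int_0^t \frac{r}{2}\,(1 + \beta(u))\,(-\sin u, \cos u)\, du$, $t \in \mathbb{R}$, is continuous and closed, that is, $\mathbf{R}(t + 2\pi) = \mathbf{R}(t)$, and it bounds an $r$-maximal subset of the Euclidean plane, namely $$C_\beta = \{\, u\,\mathbf{R}(t) + (1-u)\,\mathbf{R}(t+\pi) : t \in [0, 2\pi],\ u \in [0,1] \,\}.$$ That is, the topological boundary of $C_\beta$ is $\mathbf{R}([0, 2\pi])$, and $C_\beta$ is maximal with respect to inclusion among the subsets of $\mathbb{R}^2$ of diameter at most $r$. -/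

import Mathlib

open MeasureTheory

noncomputable section

/-- A set `C` in a metric space is `r`-bounded when its diameter is at most `r`. -/
def IsRBounded {X : Type*} [MetricSpace X] (r : ℝ) (C : Set X) : Prop :=
  Metric.ediam C ≤ ENNReal.ofReal r

/-- `C` is `r`-maximal when it is maximal (for inclusion) among the `r`-bounded sets. -/
def IsRMaximal {X : Type*} [MetricSpace X] (r : ℝ) (C : Set X) : Prop :=
  Maximal (IsRBounded r) C

/-- The Euclidean plane. -/
abbrev Plane : Type := EuclideanSpace ℝ (Fin 2)

/-- The vector `(- sin u, cos u)`. -/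
def tangentVec (u : ℝ) : Plane := !₂[-Real.sin u, Real.cos u]

/-- The `π`-antiperiodic extension to `ℝ` of a function `β` on `[0, π)`: every real `t` is uniquely
`s + m π` with `s ∈ [0, π)` and `m ∈ ℤ`, and the value at `t` is `(-1) ^ m * β s`. On `[π, 2π)` this
is `- β (t - π)`, and the function is `2π`-periodic. -/
def antiExt (β : Set.Ico (0 : ℝ) Real.pi → Set.Icc (-1 : ℝ) 1) (t : ℝ) : ℝ :=
  (-1 : ℝ) ^ (toIcoDiv Real.pi_pos 0 t) *
    (β ⟨toIcoMod Real.pi_pos 0 t, toIcoMod_mem_Ico' Real.pi_pos t⟩ : ℝ)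

theorem antiExt_coe (β : Set.Ico (0 : ℝ) Real.pi → Set.Icc (-1 : ℝ) 1)
    (t : Set.Ico (0 : ℝ) Real.pi) : antiExt β t = β t := by
  have h : toIcoMod Real.pi_pos 0 (t : ℝ) = t :=
    (toIcoMod_eq_self Real.pi_pos).2 (by simp)
  have h2 : toIcoDiv Real.pi_pos 0 (t : ℝ) = 0 :=
    toIcoDiv_eq_of_sub_zsmul_mem_Ico Real.pi_pos (by simp)
  simp [antiExt, h, h2]

theorem antiExt_antiperiodic (β : Set.Ico (0 : ℝ) Real.pi → Set.Icc (-1 : ℝ) 1) :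
    Function.Antiperiodic (antiExt β) Real.pi := by
  intro t
  have h : (-1 : ℝ) ^ (toIcoDiv Real.pi_pos 0 t + 1) = -(-1 : ℝ) ^ (toIcoDiv Real.pi_pos 0 t) := by
    rw [zpow_add_one₀ (by norm_num)]; ring
  simp only [antiExt, toIcoDiv_add_right, toIcoMod_add_right, h, neg_mul]

/-- The coefficient of `cos (k t)` in the Fourier series of a `2π`-periodic function. -/
def cosCoeff (b : ℝ → ℝ) (k : ℕ) : ℝ :=
  (1 / Real.pi) * ∫ t in (0 : ℝ)..(2 * Real.pi), b t * Real.cos (k * t)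

/-- The coefficient of `sin (k t)` in the Fourier series of a `2π`-periodic function. -/
def sinCoeff (b : ℝ → ℝ) (k : ℕ) : ℝ :=
  (1 / Real.pi) * ∫ t in (0 : ℝ)..(2 * Real.pi), b t * Real.sin (k * t)

/-- The curve `R(t) = ∫₀ᵗ (r/2) (1 + b(u)) (- sin u, cos u) du`. -/
def boundaryCurve (r : ℝ) (b : ℝ → ℝ) (t : ℝ) : Plane :=
  ∫ u in (0 : ℝ)..t, ((r / 2) * (1 + b u)) • tangentVec u

/-- The union of the segments joining `R(t)` and `R(t + π)`, for `t ∈ [0, 2π]`. -/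
def curveBody (r : ℝ) (b : ℝ → ℝ) : Set Plane :=
  {x | ∃ t ∈ Set.Icc (0 : ℝ) (2 * Real.pi), ∃ u ∈ Set.Icc (0 : ℝ) 1,
    x = u • boundaryCurve r b t + (1 - u) • boundaryCurve r b (t + Real.pi)}

end

noncomputable section

/-! Write n(t) = (cos t, sin t). Antiperiodicity and the integral condition give R(t + π) = R(t) - r
n(t) (`boundaryCurve_add_pi`), and nonnegativity of 1 + β makes R(θ) extremal on the curve in
direction n(θ) (`inner_boundaryCurve_le`). Hence the intersection K of the half-planes supporting
the curve (`supportBody`) contains the curve and lies in a strip of width r in every direction, so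
its diameter is at most r. Conversely, a point within r of the whole curve lies in K, which gives
maximality. A sign change over a half-turn puts each point of K on some segment from R(t) to R(t +
π), so K is the set C_β. -/

/-! ### Measurability and bound of the extension. -/

theorem measurable_antiExt {β : Set.Ico (0 : ℝ) Real.pi → Set.Icc (-1 : ℝ) 1}
    (hβ : Measurable β) : Measurable (antiExt β) := by
  have hdiv : Measurable (fun t : ℝ => toIcoDiv Real.pi_pos 0 t) := by
    simp only [toIcoDiv_eq_floor]
    fun_prop
  have hmod : Measurable (fun t : ℝ => toIcoMod Real.pi_pos 0 t) := by
    simp only [toIcoMod, zsmul_eq_mul]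
    have : Measurable (fun t : ℝ => ((toIcoDiv Real.pi_pos 0 t : ℤ) : ℝ)) :=
      (measurable_from_top (f := fun n : ℤ => (n : ℝ))).comp hdiv
    fun_prop
  refine Measurable.mul ?_ ?_
  · exact (measurable_from_top (f := fun n : ℤ => (-1 : ℝ) ^ n)).comp hdiv
  · exact measurable_subtype_coe.comp (hβ.comp (hmod.subtype_mk))

theorem aemeasurable_antiExt {β : Set.Ico (0 : ℝ) Real.pi → Set.Icc (-1 : ℝ) 1}
    (hβ : AEMeasurable β (volume.comap Subtype.val)) : AEMeasurable (antiExt β) := by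
  obtain ⟨g, hg, hβg⟩ := hβ
  refine ⟨antiExt g, measurable_antiExt hg, ?_⟩
  have hnull : volume ((↑) '' {x | β x ≠ g x} : Set ℝ) = 0 := by
    have : volume.comap Subtype.val {x | β x ≠ g x} = 0 := hβg
    rwa [(MeasurableEmbedding.subtype_coe measurableSet_Ico).comap_apply] at this
  have hunion : volume (⋃ m : ℤ, (fun t : ℝ => t + -(m • Real.pi)) ⁻¹'
      ((↑) '' {x | β x ≠ g x} : Set ℝ)) = 0 := by
    refine measure_iUnion_null fun m => ?_
    rw [measure_preimage_add_right]
    exact hnull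
  -- The bad points lie in countably many translates, by multiples of π, of a null set.
  refine measure_mono_null ?_ hunion
  intro t ht
  refine Set.mem_iUnion.2 ⟨toIcoDiv Real.pi_pos 0 t, ?_⟩
  refine ⟨⟨toIcoMod Real.pi_pos 0 t, toIcoMod_mem_Ico' Real.pi_pos t⟩, ?_, sub_eq_add_neg _ _⟩
  intro h
  apply ht
  simp [antiExt, h]

theorem abs_antiExt_le_one (β : Set.Ico (0 : ℝ) Real.pi → Set.Icc (-1 : ℝ) 1) (t : ℝ) :
    |antiExt β t| ≤ 1 := by
  have h := (β ⟨toIcoMod Real.pi_pos 0 t, toIcoMod_mem_Ico' Real.pi_pos t⟩).2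
  rw [antiExt, abs_mul, abs_zpow, abs_neg, abs_one, one_zpow, one_mul]
  exact abs_le.2 h

/-! ### The rotating orthonormal frame. -/

/-- The vector `(cos u, sin u)`. -/
def normalVec (u : ℝ) : Plane := !₂[Real.cos u, Real.sin u]

theorem inner_normalVec (x : Plane) (θ : ℝ) :
    inner ℝ x (normalVec θ) = x 0 * Real.cos θ + x 1 * Real.sin θ := by
  simp [normalVec, PiLp.inner_apply, Fin.sum_univ_two, mul_comm]

theorem inner_tangentVec (x : Plane) (θ : ℝ) :
    inner ℝ x (tangentVec θ) = -x 0 * Real.sin θ + x 1 * Real.cos θ := by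
  simp [tangentVec, PiLp.inner_apply, Fin.sum_univ_two, mul_comm]

theorem inner_tangentVec_normalVec (u θ : ℝ) :
    inner ℝ (tangentVec u) (normalVec θ) = Real.sin (θ - u) := by
  rw [inner_normalVec, Real.sin_sub]
  simp [tangentVec]
  ring

theorem inner_normalVec_self (θ : ℝ) : inner ℝ (normalVec θ) (normalVec θ) = 1 := by
  rw [inner_normalVec]
  simp [normalVec, ← sq]

theorem norm_normalVec (θ : ℝ) : ‖normalVec θ‖ = 1 := by
  have h := inner_normalVec_self θ
  rw [real_inner_self_eq_norm_sq] at h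
  nlinarith [norm_nonneg (normalVec θ)]

theorem normalVec_add_pi (u : ℝ) : normalVec (u + Real.pi) = -normalVec u := by
  ext i; fin_cases i <;> simp [normalVec]

theorem tangentVec_add_pi (u : ℝ) : tangentVec (u + Real.pi) = -tangentVec u := by
  ext i; fin_cases i <;> simp [tangentVec]

theorem continuous_normalVec : Continuous normalVec := by
  unfold normalVec; fun_prop

theorem continuous_tangentVec : Continuous tangentVec := by
  unfold tangentVec; fun_prop

theorem eq_inner_normalVec_add_inner_tangentVec (x : Plane) (θ : ℝ) :
    x = (inner ℝ x (normalVec θ) : ℝ) • normalVec θ +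
      (inner ℝ x (tangentVec θ) : ℝ) • tangentVec θ := by
  rw [inner_normalVec, inner_tangentVec]
  ext i
  fin_cases i
  · simp [normalVec, tangentVec]
    linear_combination (-x 0) * Real.sin_sq_add_cos_sq θ
  · simp [normalVec, tangentVec]
    linear_combination (-x 1) * Real.sin_sq_add_cos_sq θ

theorem exists_eq_norm_smul_normalVec (x : Plane) : ∃ θ, x = ‖x‖ • normalVec θ := by
  have hn : ‖(⟨x 0, x 1⟩ : ℂ)‖ = ‖x‖ := by
    rw [EuclideanSpace.norm_eq, Fin.sum_univ_two, Complex.norm_eq_sqrt_sq_add_sq]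
    simp
  refine ⟨Complex.arg ⟨x 0, x 1⟩, ?_⟩
  rw [← hn]
  ext i
  fin_cases i
  · simp [normalVec]
  · simp [normalVec]

theorem hasDerivAt_normalVec (u : ℝ) : HasDerivAt normalVec (tangentVec u) u := by
  have h : HasDerivAt (fun u => ![Real.cos u, Real.sin u]) ![-Real.sin u, Real.cos u] u := by
    rw [hasDerivAt_pi]
    intro i
    fin_cases i
    · exact Real.hasDerivAt_cos u
    · exact Real.hasDerivAt_sin u
  exact (PiLp.hasFDerivAt_toLp 2 _).comp_hasDerivAt u h

theorem integral_tangentVec (a c : ℝ) :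
    ∫ u in a..c, tangentVec u = normalVec c - normalVec a :=
  intervalIntegral.integral_eq_sub_of_hasDerivAt (fun u _ => hasDerivAt_normalVec u)
    (continuous_tangentVec.intervalIntegrable _ _)

/-! ### The curve: closedness and extremal points. -/

section Curve

variable {r : ℝ} {b : ℝ → ℝ}

theorem intervalIntegrable_smul_of_bounded {E : Type*} [NormedAddCommGroup E] [NormedSpace ℝ E]
    (hm : AEMeasurable b) (hb : ∀ t, |b t| ≤ 1) {f : ℝ → E} (hf : Continuous f) (a c : ℝ) :
    IntervalIntegrable (fun u => b u • f u) volume a c := by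
  refine (hf.intervalIntegrable a c).mono_fun ?_ (ae_of_all _ fun u => ?_)
  · exact (hm.aestronglyMeasurable.smul hf.aestronglyMeasurable).restrict
  · beta_reduce
    rw [norm_smul]
    exact mul_le_of_le_one_left (norm_nonneg _) (hb u)

theorem intervalIntegrable_boundaryCurve (hm : AEMeasurable b) (hb : ∀ t, |b t| ≤ 1) (a c : ℝ) :
    IntervalIntegrable (fun u => ((r / 2) * (1 + b u)) • tangentVec u) volume a c := by
  have h := ((continuous_tangentVec.intervalIntegrable a c).add
    (intervalIntegrable_smul_of_bounded hm hb continuous_tangentVec a c)).smul (r / 2)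
  refine h.congr fun u _ => ?_
  simp [mul_smul, add_smul]

theorem boundaryCurve_sub (hm : AEMeasurable b) (hb : ∀ t, |b t| ≤ 1) (s t : ℝ) :
    boundaryCurve r b t - boundaryCurve r b s =
      ∫ u in s..t, ((r / 2) * (1 + b u)) • tangentVec u :=
  intervalIntegral.integral_interval_sub_left (intervalIntegrable_boundaryCurve hm hb _ _)
    (intervalIntegrable_boundaryCurve hm hb _ _)

theorem continuous_boundaryCurve (hm : AEMeasurable b) (hb : ∀ t, |b t| ≤ 1) :
    Continuous (boundaryCurve r b) :=
  intervalIntegral.continuous_primitive (intervalIntegrable_boundaryCurve hm hb) 0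

/-- A product of two antiperiodic factors, `b u • tangentVec u` is π-periodic, so it integrates to
zero over every half-turn; only the integral of `tangentVec` remains. -/
theorem boundaryCurve_add_pi (hm : AEMeasurable b) (hb : ∀ t, |b t| ≤ 1)
    (hanti : Function.Antiperiodic b Real.pi)
    (hint : ∫ u in (0 : ℝ)..Real.pi, b u • tangentVec u = 0) (t : ℝ) :
    boundaryCurve r b (t + Real.pi) = boundaryCurve r b t - r • normalVec t := by
  have hper : Function.Periodic (fun u => b u • tangentVec u) Real.pi := fun u => by
    simp [hanti u, tangentVec_add_pi]
  have hzero : ∫ u in t..t + Real.pi, b u • tangentVec u = 0 := by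
    rw [hper.intervalIntegral_add_eq t 0, zero_add, hint]
  rw [← sub_eq_zero, sub_sub_eq_add_sub, add_sub_right_comm, boundaryCurve_sub hm hb]
  have : ∀ u, ((r / 2) * (1 + b u)) • tangentVec u =
      (r / 2) • (tangentVec u + b u • tangentVec u) := fun u => by simp [mul_smul, add_smul]
  simp only [this]
  rw [intervalIntegral.integral_smul, intervalIntegral.integral_add
    (continuous_tangentVec.intervalIntegrable _ _)
    (intervalIntegrable_smul_of_bounded hm hb continuous_tangentVec _ _), hzero,
    integral_tangentVec, normalVec_add_pi]
  module

theorem periodic_boundaryCurve (hm : AEMeasurable b) (hb : ∀ t, |b t| ≤ 1)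
    (hanti : Function.Antiperiodic b Real.pi)
    (hint : ∫ u in (0 : ℝ)..Real.pi, b u • tangentVec u = 0) :
    Function.Periodic (boundaryCurve r b) (2 * Real.pi) := fun t => by
  rw [two_mul, ← add_assoc, boundaryCurve_add_pi hm hb hanti hint,
    boundaryCurve_add_pi hm hb hanti hint, normalVec_add_pi]
  module

theorem inner_boundaryCurve_sub (hm : AEMeasurable b) (hb : ∀ t, |b t| ≤ 1) (s t θ : ℝ) :
    inner ℝ (boundaryCurve r b t - boundaryCurve r b s) (normalVec θ) =
      ∫ u in s..t, (r / 2) * (1 + b u) * Real.sin (θ - u) := by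
  rw [boundaryCurve_sub hm hb, real_inner_comm]
  have h := (innerSL ℝ (normalVec θ)).intervalIntegral_comp_comm
    (intervalIntegrable_boundaryCurve (r := r) hm hb s t)
  simp only [innerSL_apply_apply] at h
  rw [← h]
  refine intervalIntegral.integral_congr fun u _ => ?_
  simp only [inner_smul_right]
  rw [real_inner_comm, inner_tangentVec_normalVec]

theorem inner_boundaryCurve_le (hr : 0 < r) (hm : AEMeasurable b) (hb : ∀ t, |b t| ≤ 1)
    (hper : Function.Periodic (boundaryCurve r b) (2 * Real.pi)) (t θ : ℝ) :
    inner ℝ (boundaryCurve r b t) (normalVec θ) ≤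
      inner ℝ (boundaryCurve r b θ) (normalVec θ) := by
  have hπ := Real.pi_pos
  have hw : ∀ u, 0 ≤ (r / 2) * (1 + b u) := fun u => by
    have := (abs_le.1 (hb u)).1
    exact mul_nonneg (by positivity) (by linarith)
  -- Within π of θ on either side, sin (θ - u) keeps one sign between s and θ.
  obtain ⟨s, hs, hst⟩ := hper.exists_mem_Ico (by positivity : (0 : ℝ) < 2 * Real.pi) t (θ - Real.pi)
  rw [hst]
  rcases le_total s θ with h | h
  · have key := inner_boundaryCurve_sub (r := r) hm hb s θ θ
    have hnn : 0 ≤ ∫ u in s..θ, (r / 2) * (1 + b u) * Real.sin (θ - u) :=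
      intervalIntegral.integral_nonneg h fun u hu =>
        mul_nonneg (hw u) (Real.sin_nonneg_of_nonneg_of_le_pi (by linarith [hu.2])
          (by linarith [hu.1, hs.1]))
    rw [inner_sub_left] at key
    linarith
  · have key := inner_boundaryCurve_sub (r := r) hm hb θ s θ
    have hnn : 0 ≤ ∫ u in θ..s, -((r / 2) * (1 + b u) * Real.sin (θ - u)) :=
      intervalIntegral.integral_nonneg h fun u hu => by
        have h2 : 0 ≤ Real.sin (u - θ) := Real.sin_nonneg_of_nonneg_of_le_pi (by linarith [hu.1])
          (by linarith [hu.2, hs.2])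
        rw [← neg_sub u θ, Real.sin_neg, mul_neg, neg_neg]
        exact mul_nonneg (hw u) h2
    rw [inner_sub_left] at key
    rw [intervalIntegral.integral_neg] at hnn
    linarith

end Curve

/-! ### The intersection of the supporting half-planes. -/

/-- The intersection of the half-planes supporting a parametrized curve `R`, where the point of
parameter `θ` is taken to be extremal in the direction `(cos θ, sin θ)`. -/
def supportBody (R : ℝ → Plane) : Set Plane :=
  {x | ∀ θ, inner ℝ x (normalVec θ) ≤ inner ℝ (R θ) (normalVec θ)}

section SupportBody

variable {r : ℝ} {R : ℝ → Plane}

/-- The half-plane at θ + π bounds the other side of a strip of width r. -/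
theorem inner_le_of_mem_supportBody (hpi : ∀ t, R (t + Real.pi) = R t - r • normalVec t)
    {x : Plane} (hx : x ∈ supportBody R) (θ : ℝ) :
    inner ℝ (R θ) (normalVec θ) - r ≤ inner ℝ x (normalVec θ) := by
  have h := hx (θ + Real.pi)
  rw [hpi, normalVec_add_pi, inner_neg_right, inner_neg_right, inner_sub_left, inner_smul_left,
    inner_normalVec_self] at h
  simp at h
  linarith

theorem dist_le_of_mem_supportBody (hpi : ∀ t, R (t + Real.pi) = R t - r • normalVec t)
    {x y : Plane} (hx : x ∈ supportBody R) (hy : y ∈ supportBody R) : dist x y ≤ r := by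
  obtain ⟨θ, hθ⟩ := exists_eq_norm_smul_normalVec (x - y)
  have h : inner ℝ (x - y) (normalVec θ) = ‖x - y‖ := by
    conv_lhs => rw [hθ]
    rw [inner_smul_left, inner_normalVec_self]
    simp
  rw [dist_eq_norm, ← h, inner_sub_left]
  linarith [hx θ, inner_le_of_mem_supportBody hpi hy θ]

/-- Cauchy–Schwarz against R(θ + π) suffices, since R(θ) = R(θ + π) + r n(θ). -/
theorem mem_supportBody_of_dist_le (hpi : ∀ t, R (t + Real.pi) = R t - r • normalVec t)
    {y : Plane} (hy : ∀ t, dist y (R t) ≤ r) : y ∈ supportBody R := by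
  intro θ
  have h := real_inner_le_norm (y - R (θ + Real.pi)) (normalVec θ)
  rw [norm_normalVec, mul_one, ← dist_eq_norm] at h
  replace h := h.trans (hy _)
  rw [hpi, inner_sub_left, inner_sub_left, inner_smul_left, inner_normalVec_self] at h
  simp at h
  linarith

theorem isClosed_supportBody : IsClosed (supportBody R) := by
  simp only [supportBody, Set.ofPred_forall]
  exact isClosed_iInter fun θ => isClosed_le (by fun_prop) continuous_const

theorem exists_eq_segment_of_mem_supportBody (hr : 0 < r) (hc : Continuous R)
    (hpi : ∀ t, R (t + Real.pi) = R t - r • normalVec t) {x : Plane} (hx : x ∈ supportBody R) :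
    ∃ t ∈ Set.Icc (0 : ℝ) (2 * Real.pi), ∃ u ∈ Set.Icc (0 : ℝ) 1,
      x = u • R t + (1 - u) • R (t + Real.pi) := by
  have hπ := Real.pi_pos
  -- At a zero of f, x lies on the normal line through R(t), which also contains R(t + π).
  set f : ℝ → ℝ := fun t => inner ℝ (x - R t) (tangentVec t) with hf
  have hfc : Continuous f := by
    have := continuous_tangentVec
    fun_prop
  have horth : inner ℝ (normalVec 0) (tangentVec 0) = (0 : ℝ) := by
    rw [inner_tangentVec]; simp [normalVec]
  have hfpi : f Real.pi = -f 0 := by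
    have h1 := hpi 0
    have h2 := tangentVec_add_pi 0
    rw [zero_add] at h1 h2
    simp only [hf, h1, h2, inner_neg_right, inner_sub_left, inner_smul_left, horth]
    simp
    ring
  obtain ⟨t, ht, hft⟩ : ∃ t ∈ Set.uIcc 0 Real.pi, f t = 0 := by
    refine intermediate_value_uIcc hfc.continuousOn ?_
    rw [hfpi, Set.mem_uIcc]
    rcases le_total (f 0) 0 with h | h
    · exact Or.inl ⟨h, by linarith⟩
    · exact Or.inr ⟨by linarith, h⟩
  rw [Set.uIcc_of_le hπ.le] at ht
  have hdec := eq_inner_normalVec_add_inner_tangentVec (x - R t) t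
  rw [show inner ℝ (x - R t) (tangentVec t) = (0 : ℝ) from hft, zero_smul, add_zero] at hdec
  set c : ℝ := inner ℝ (x - R t) (normalVec t) with hcdef
  have hc0 : c ≤ 0 := by
    rw [hcdef, inner_sub_left]; linarith [hx t]
  have hcr : -r ≤ c := by
    rw [hcdef, inner_sub_left]; linarith [inner_le_of_mem_supportBody hpi hx t]
  -- Here x = R(t) + c n(t), and the second weight is -c / r.
  refine ⟨t, ⟨ht.1, by linarith [ht.2]⟩, 1 + c / r, ⟨?_, ?_⟩, ?_⟩
  · have : -1 ≤ c / r := by rw [le_div_iff₀ hr]; linarith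
    linarith
  · have : c / r ≤ 0 := div_nonpos_of_nonpos_of_nonneg hc0 hr.le
    linarith
  · rw [hpi, ← sub_eq_zero]
    rw [sub_eq_iff_eq_add] at hdec
    conv_lhs => rw [hdec]
    have : c = c / r * r := by field_simp
    conv_lhs => enter [1, 1, 1]; rw [this]
    module

theorem convex_supportBody : Convex ℝ (supportBody R) := by
  intro x hx y hy a c ha hc hac θ
  rw [inner_add_left, inner_smul_left, inner_smul_left]
  simp only [conj_trivial]
  calc _ ≤ a * inner ℝ (R θ) (normalVec θ) + c * inner ℝ (R θ) (normalVec θ) :=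
        add_le_add (mul_le_mul_of_nonneg_left (hx θ) ha) (mul_le_mul_of_nonneg_left (hy θ) hc)
    _ = _ := by rw [← add_mul, hac, one_mul]

theorem frontier_supportBody (hr : 0 < r) (hc : Continuous R)
    (hper : Function.Periodic R (2 * Real.pi))
    (hpi : ∀ t, R (t + Real.pi) = R t - r • normalVec t) (hmem : ∀ t, R t ∈ supportBody R) :
    frontier (supportBody R) = R '' Set.Icc 0 (2 * Real.pi) := by
  have hπ := Real.pi_pos
  rw [isClosed_supportBody.frontier_eq]
  ext x
  constructor
  · rintro ⟨hx, hxi⟩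
    obtain ⟨θ, hθ, hmin⟩ := (isCompact_Icc (a := (0 : ℝ)) (b := 2 * Real.pi)).exists_isMinOn
      ⟨0, by constructor <;> linarith⟩
      (f := fun θ => (inner ℝ (R θ) (normalVec θ) - inner ℝ x (normalVec θ) : ℝ))
      (by have := continuous_normalVec; fun_prop)
    set ε : ℝ := inner ℝ (R θ) (normalVec θ) - inner ℝ x (normalVec θ) with hε
    have hε0 : ε ≤ 0 := by
      -- If the least slack ε were positive, the ball of radius ε about x would satisfy every
      -- constraint.
      by_contra! hpos
      refine hxi (mem_interior_iff_mem_nhds.2 ?_)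
      refine Filter.mem_of_superset (Metric.ball_mem_nhds x hpos) fun y hy φ => ?_
      have hgper : Function.Periodic
          (fun θ => (inner ℝ (R θ) (normalVec θ) - inner ℝ x (normalVec θ) : ℝ))
          (2 * Real.pi) := fun t => by simp [hper t, inner_normalVec]
      obtain ⟨s, hs, hsφ⟩ := hgper.exists_mem_Ico₀ (by positivity) φ
      have h1 := hmin (Set.Ico_subset_Icc_self hs)
      simp only [Set.mem_ofPred_eq] at h1 hsφ
      have h2 := real_inner_le_norm (y - x) (normalVec φ)
      rw [norm_normalVec, mul_one, inner_sub_left] at h2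
      rw [Metric.mem_ball, dist_eq_norm] at hy
      linarith
    have heq : inner ℝ (x - R (θ + Real.pi)) (normalVec θ) = r - ε := by
      rw [hpi, inner_sub_left, inner_sub_left, inner_smul_left, inner_normalVec_self, hε]
      simp
      ring
    have hε' : ε = 0 := le_antisymm hε0 (by linarith [hx θ])
    refine ⟨θ, hθ, ?_⟩
    have hd := dist_le_of_mem_supportBody hpi hx (hmem (θ + Real.pi))
    rw [dist_eq_norm] at hd
    -- A vector of norm at most r whose component along n(θ) is r must equal r n(θ); hence x = R(θ).
    have hz : ‖x - R (θ + Real.pi) - r • normalVec θ‖ ^ 2 ≤ 0 := by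
      rw [norm_sub_sq_real, inner_smul_right, heq, hε', norm_smul, norm_normalVec,
        Real.norm_of_nonneg hr.le]
      nlinarith [norm_nonneg (x - R (θ + Real.pi))]
    have hz' : x - R (θ + Real.pi) - r • normalVec θ = 0 := by
      rw [← norm_eq_zero]
      exact pow_eq_zero_iff two_ne_zero |>.1 (le_antisymm hz (sq_nonneg _))
    rw [hpi] at hz'
    rw [← sub_eq_zero, ← neg_eq_zero, ← hz']
    module
  · rintro ⟨θ, -, rfl⟩
    refine ⟨hmem θ, fun hi => ?_⟩
    -- Any outward push along n(θ) violates the constraint at θ itself.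
    have hcont : Continuous fun δ : ℝ => R θ + δ • normalVec θ := by fun_prop
    have hnear : ∀ᶠ δ in nhds (0 : ℝ), R θ + δ • normalVec θ ∈ supportBody R := by
      apply hcont.continuousAt.eventually_mem
      simpa using mem_interior_iff_mem_nhds.1 hi
    obtain ⟨δ, hδ, hmemδ⟩ := ((hnear.filter_mono nhdsWithin_le_nhds).and
      (self_mem_nhdsWithin (s := Set.Ioi (0 : ℝ)))).exists
    have h := hδ θ
    rw [inner_add_left, inner_smul_left, inner_normalVec_self] at h
    simp at h
    exact absurd hmemδ (not_lt.2 h)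

end SupportBody

/-! ### Vanishing Fourier coefficients. -/

section Fourier

variable {b : ℝ → ℝ}

theorem integral_eq_zero_of_antiperiodic {f : ℝ → ℝ} {c : ℝ} (hf : Function.Antiperiodic f c)
    (hi : ∀ a d, IntervalIntegrable f volume a d) : ∫ t in (0 : ℝ)..(2 * c), f t = 0 := by
  rw [← intervalIntegral.integral_add_adjacent_intervals (hi 0 c) (hi c (2 * c))]
  have h : ∫ t in c..(2 * c), f t = ∫ t in (0 : ℝ)..c, f (t + c) := by
    rw [intervalIntegral.integral_comp_add_right, zero_add, two_mul]
  rw [h]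
  simp only [hf _, intervalIntegral.integral_neg, add_neg_cancel]

theorem integral_eq_two_mul_of_periodic {f : ℝ → ℝ} {c : ℝ} (hf : Function.Periodic f c)
    (hi : ∀ a d, IntervalIntegrable f volume a d) :
    ∫ t in (0 : ℝ)..(2 * c), f t = 2 * ∫ t in (0 : ℝ)..c, f t := by
  rw [← intervalIntegral.integral_add_adjacent_intervals (hi 0 c) (hi c (2 * c))]
  have h : ∫ t in c..(2 * c), f t = ∫ t in (0 : ℝ)..c, f (t + c) := by
    rw [intervalIntegral.integral_comp_add_right, zero_add, two_mul]
  rw [h]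
  simp only [hf _]
  ring

theorem cosCoeff_eq_zero_of_even (hm : AEMeasurable b) (hb : ∀ t, |b t| ≤ 1)
    (hanti : Function.Antiperiodic b Real.pi) {k : ℕ} (hk : Even k) : cosCoeff b k = 0 := by
  rw [cosCoeff, integral_eq_zero_of_antiperiodic, mul_zero]
  · intro t
    obtain ⟨m, rfl⟩ := hk
    have : ((m + m : ℕ) : ℝ) * (t + Real.pi) = (m + m : ℕ) * t + m * (2 * Real.pi) := by
      push_cast; ring
    simp only [hanti t, this, Real.cos_add_nat_mul_two_pi, neg_mul]
  · exact intervalIntegrable_smul_of_bounded hm hb (by fun_prop)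

theorem sinCoeff_eq_zero_of_even (hm : AEMeasurable b) (hb : ∀ t, |b t| ≤ 1)
    (hanti : Function.Antiperiodic b Real.pi) {k : ℕ} (hk : Even k) : sinCoeff b k = 0 := by
  rw [sinCoeff, integral_eq_zero_of_antiperiodic, mul_zero]
  · intro t
    obtain ⟨m, rfl⟩ := hk
    have : ((m + m : ℕ) : ℝ) * (t + Real.pi) = (m + m : ℕ) * t + m * (2 * Real.pi) := by
      push_cast; ring
    simp only [hanti t, this, Real.sin_add_nat_mul_two_pi, neg_mul]
  · exact intervalIntegrable_smul_of_bounded hm hb (by fun_prop)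

theorem integral_mul_inner_tangentVec (hm : AEMeasurable b) (hb : ∀ t, |b t| ≤ 1)
    (hint : ∫ u in (0 : ℝ)..Real.pi, b u • tangentVec u = 0) (v : Plane) :
    ∫ u in (0 : ℝ)..Real.pi, b u * inner ℝ v (tangentVec u) = 0 := by
  have h := (innerSL ℝ v).intervalIntegral_comp_comm
    (intervalIntegrable_smul_of_bounded hm hb continuous_tangentVec 0 Real.pi)
  simpa only [hint, map_zero, innerSL_apply_apply, inner_smul_right] using h

theorem cosCoeff_one_eq_zero (hm : AEMeasurable b) (hb : ∀ t, |b t| ≤ 1)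
    (hanti : Function.Antiperiodic b Real.pi)
    (hint : ∫ u in (0 : ℝ)..Real.pi, b u • tangentVec u = 0) : cosCoeff b 1 = 0 := by
  -- This vector selects the component cos u of `tangentVec u`.
  have h := integral_mul_inner_tangentVec hm hb hint !₂[0, 1]
  simp only [inner_tangentVec] at h
  rw [cosCoeff, integral_eq_two_mul_of_periodic]
  · simp at h
    simp [h]
  · intro t
    simp [hanti t]
  · exact intervalIntegrable_smul_of_bounded hm hb (by fun_prop)

theorem sinCoeff_one_eq_zero (hm : AEMeasurable b) (hb : ∀ t, |b t| ≤ 1)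
    (hanti : Function.Antiperiodic b Real.pi)
    (hint : ∫ u in (0 : ℝ)..Real.pi, b u • tangentVec u = 0) : sinCoeff b 1 = 0 := by
  have h := integral_mul_inner_tangentVec hm hb hint !₂[-1, 0]
  simp only [inner_tangentVec] at h
  rw [sinCoeff, integral_eq_two_mul_of_periodic]
  · simp at h
    simp [h]
  · intro t
    simp [hanti t]
  · exact intervalIntegrable_smul_of_bounded hm hb (by fun_prop)

end Fourier

end

theorem theorem4p9 (r : ℝ) (hr : 0 < r)
    (β : Set.Ico (0 : ℝ) Real.pi → Set.Icc (-1 : ℝ) 1)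
    -- `β` is Lebesgue measurable
    (hβ : AEMeasurable β (volume.comap Subtype.val))
    (hint : ∫ u in (0 : ℝ)..Real.pi, antiExt β u • tangentVec u = 0) :
    (∀ k : ℕ, (cosCoeff (antiExt β) k ≠ 0 ∨ sinCoeff (antiExt β) k ≠ 0) → Odd k ∧ 1 < k) ∧
    Continuous (boundaryCurve r (antiExt β)) ∧
    -- the curve is closed and its image is the boundary of the `r`-maximal set
    Function.Periodic (boundaryCurve r (antiExt β)) (2 * Real.pi) ∧
    frontier (curveBody r (antiExt β)) =
      boundaryCurve r (antiExt β) '' Set.Icc 0 (2 * Real.pi) ∧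
    IsRMaximal r (curveBody r (antiExt β)) := by
  have hm := aemeasurable_antiExt hβ
  have hb := abs_antiExt_le_one β
  have hanti := antiExt_antiperiodic β
  have hc := continuous_boundaryCurve (r := r) hm hb
  have hper := periodic_boundaryCurve (r := r) hm hb hanti hint
  have hpi := boundaryCurve_add_pi (r := r) hm hb hanti hint
  have hmem : ∀ t, boundaryCurve r (antiExt β) t ∈ supportBody (boundaryCurve r (antiExt β)) :=
    fun t => inner_boundaryCurve_le hr hm hb hper t
  have hbody : curveBody r (antiExt β) = supportBody (boundaryCurve r (antiExt β)) := by
    refine Set.Subset.antisymm ?_ fun x hx => exists_eq_segment_of_mem_supportBody hr hc hpi hx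
    rintro x ⟨t, -, u, hu, rfl⟩
    exact convex_supportBody (hmem _) (hmem _) hu.1 (sub_nonneg.2 hu.2) (by ring)
  refine ⟨fun k hk => ?_, hc, hper, ?_, ?_⟩
  · have hodd : Odd k := by
      by_contra hne
      rw [Nat.not_odd_iff_even] at hne
      rcases hk with h | h
      · exact h (cosCoeff_eq_zero_of_even hm hb hanti hne)
      · exact h (sinCoeff_eq_zero_of_even hm hb hanti hne)
    refine ⟨hodd, lt_of_le_of_ne hodd.pos ?_⟩
    rintro rfl
    rcases hk with h | h
    · exact h (cosCoeff_one_eq_zero hm hb hanti hint)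
    · exact h (sinCoeff_one_eq_zero hm hb hanti hint)
  · rw [hbody]
    exact frontier_supportBody hr hc hper hpi hmem
  · rw [hbody]
    refine ⟨Metric.ediam_le fun x hx y hy => ?_, fun D hD hsub y hy => ?_⟩
    · rw [edist_dist]
      exact ENNReal.ofReal_le_ofReal (dist_le_of_mem_supportBody hpi hx hy)
    -- A competitor D contains the curve, so each of its points is within r of every R(t).
    · refine mem_supportBody_of_dist_le hpi fun t => ?_
      have h := (Metric.edist_le_ediam_of_mem hy (hsub (hmem t))).trans hD
      rwa [edist_dist, ENNReal.ofReal_le_ofReal_iff hr.le] at h
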